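/- Let $T$ be a locally finite simplicial tree, and give $\operatorname{Aut}(T)$ (all automorphisms, inversions of edges included) the compact-open topology for its action on the geometric realisation of $T$. There is an algorithm which, given a finite set $X=\{x_1,\dots,x_n\}\subseteq\operatorname{Aut}(T)$, decides whether the group $G=\langle X\rangle$ is discrete and free (the trivial group being free of rank $0$). Here "algorithm" and "given" are meant as follows. The algorithm is one computable procedure, the same for all $T$ and $X$. It receives $n$, and it may compute with $X$ exactly, that is, ask finitely many questions, each depending computably on $n$ and the earlier answers, of the two kinds: (a) does a given word in $x_1^{\pm1},\dots,x_n^{\pm1}$ represent the identity of $\operatorname{Aut}(T)$? (b) do two given names of vertices denote the same vertex? A name of a vertex is a finite sequence of steps from a fixed, arbitrarily chosen base vertex $v_0$ of $T$, where a step moves from a vertex $v$ to its $k$-th neighbour, in an arbitrarily fixed listing of the finitely many neighbours of each vertex, or to $x_i^{\pm1}v$. For every locally finite tree $T$, every base vertex, every listing of neighbours and every finite $X$ (listed in any way), the algorithm stops after finitely many questions, and its verdict is "yes" if and only if $G$ is discrete in the compact-open topology and free. -/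

import Mathlib

namespace TreeAut

universe u

/-! ### The compact-open topology on the automorphism group of a graph -/

/-- The geometric realisation of a graph, in barycentric coordinates: a point is a finitely
supported probability weight on the vertices whose support lies in a single vertex or in the two
ends of a single edge. It is topologised as a subspace of `V → ℝ`, which for a locally finite graph
(indeed also for the metric in which edges are unit segments) gives the usual topology. -/
def realization {V : Type u} (T : SimpleGraph V) : Set (V → ℝ) :=
  {p | (∀ v, 0 ≤ p v) ∧
    (∃ a b, (a = b ∨ T.Adj a b) ∧ Function.support p ⊆ {a, b}) ∧
    ∑ᶠ v, p v = 1}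

/-- An automorphism permutes the barycentric coordinates of a point of the realisation. -/
theorem comp_symm_mem_realization {V : Type u} {T : SimpleGraph V} (g : T ≃g T) {p : V → ℝ}
    (hp : p ∈ realization T) : (fun v => p (g.symm v)) ∈ realization T := by
  obtain ⟨h0, ⟨a, b, hab, hs⟩, h1⟩ := hp
  refine ⟨fun v => h0 _, ⟨g a, g b, ?_, ?_⟩, ?_⟩
  · rcases hab with h | h
    · exact Or.inl (by rw [h])
    · exact Or.inr (g.map_rel_iff.2 h)
  · intro v hv
    have hv' : g.symm v ∈ ({a, b} : Set V) := hs hv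
    rcases hv' with h | h
    · left
      rw [← h]
      exact (g.apply_symm_apply v).symm
    · right
      have h' : g.symm v = b := h
      show v = g b
      rw [← h']
      exact (g.apply_symm_apply v).symm
  · rw [← h1]
    exact finsum_comp_equiv g.symm.toEquiv (f := p)

/-- The homeomorphism of the realisation induced by an automorphism, as a continuous map. -/
def realizationMap {V : Type u} (T : SimpleGraph V) (g : T ≃g T) :
    C(realization T, realization T) where
  toFun p := ⟨fun v => p.1 (g.symm v), comp_symm_mem_realization g p.2⟩
  continuous_toFun :=
    Continuous.subtype_mk
      (continuous_pi fun v =>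
        (continuous_apply (A := fun _ : V => ℝ) (g.symm v)).comp
          (continuous_subtype_val (p := fun p => p ∈ realization T))) _

/-- The compact-open topology on `Aut(T)`, for its action on the geometric realisation of `T`. -/
abbrev compactOpenTopology {V : Type u} (T : SimpleGraph V) : TopologicalSpace (T ≃g T) :=
  TopologicalSpace.induced (realizationMap T) ContinuousMap.compactOpen

/-- A subgroup of `Aut(T)` is discrete: its subspace topology is the discrete one. -/
def IsDiscreteSubgroup {V : Type u} (T : SimpleGraph V) (G : Subgroup (T ≃g T)) : Prop :=
  @DiscreteTopology G (@instTopologicalSpaceSubtype _ (· ∈ G) (compactOpenTopology T))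

/-! ### Exact computation with a finite list of automorphisms

The algorithm has no other access to the tree and to the automorphisms than through yes/no questions
about objects that it names by finite expressions. -/

/-- `(i, true)` stands for the `i`-th given automorphism, `(i, false)` for its inverse. -/
abbrev Letter := ℕ × Bool

/-- A word in the given automorphisms and their inverses. -/
abbrev Word := List Letter

/-- A way to get from one vertex to another: to the `k`-th neighbour (`Sum.inl k`), or to the image
under a given automorphism or its inverse (`Sum.inr a`). -/
abbrev Step := ℕ ⊕ Letter

/-- A name for a vertex: steps that lead to it from the base vertex, the last step first. -/
abbrev VertexName := List Step

/-- The questions: does this word represent the identity of `Aut(T)`? do these two names denote the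
same vertex? -/
abbrev Query := Word ⊕ (VertexName × VertexName)

section Evaluation

variable {V : Type u} {T : SimpleGraph V}

/-- The automorphism denoted by a letter (the identity if the index is out of range). -/
def evalLetter (L : List (T ≃g T)) (a : Letter) : T ≃g T :=
  if a.2 then L.getD a.1 1 else (L.getD a.1 1)⁻¹

/-- The automorphism denoted by a word. -/
def evalWord (L : List (T ≃g T)) (w : Word) : T ≃g T :=
  (w.map (evalLetter L)).prod

/-- One step from a vertex, given for every vertex a list of its neighbours (the vertex stays where
it is if it has no `k`-th neighbour). -/
def evalStep (nbrs : V → List V) (L : List (T ≃g T)) (s : Step) (v : V) : V :=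
  match s with
  | Sum.inl k => (nbrs v).getD k v
  | Sum.inr a => evalLetter L a v

/-- The vertex denoted by a name. -/
def evalVertex (v₀ : V) (nbrs : V → List V) (L : List (T ≃g T)) (p : VertexName) : V :=
  p.foldr (evalStep nbrs L) v₀

open Classical in
/-- The true answer to a question. -/
noncomputable def answer (v₀ : V) (nbrs : V → List V) (L : List (T ≃g T)) (q : Query) : Bool :=
  match q with
  | Sum.inl w => decide (evalWord L w = 1)
  | Sum.inr (p, p') => decide (evalVertex v₀ nbrs L p = evalVertex v₀ nbrs L p')

end Evaluation

/-- An algorithm: from the number of given automorphisms and the answers received so far (the latest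
first) it computes either its next question or its verdict, after which it has stopped. -/
structure Algorithm where
  next : ℕ → List Bool → Query ⊕ Bool
  computable : Computable₂ next

/-- The answers received in the first `k` rounds, the latest first. -/
def Algorithm.history (A : Algorithm) (n : ℕ) (ans : Query → Bool) : ℕ → List Bool
  | 0 => []
  | k + 1 =>
    match A.next n (A.history n ans k) with
    | Sum.inl q => ans q :: A.history n ans k
    | Sum.inr _ => A.history n ans k

/-- The algorithm stops after finitely many rounds with verdict `b`. -/
def Algorithm.Outputs (A : Algorithm) (n : ℕ) (ans : Query → Bool) (b : Bool) : Prop :=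
  ∃ k, A.next n (A.history n ans k) = Sum.inr b

end TreeAut

/-! The group is discrete and free exactly when no nontrivial element has a square that fixes a
vertex. Suppose it is discrete and free, and let an element fix a vertex. By local finiteness, each
vertex is fixed by some positive power of this element. Discreteness provides a finite set of
vertices with trivial pointwise stabiliser, so the element has finite order, and a free group has no
torsion (`eq_one_of_apply_eq_of_isDiscreteSubgroup`). Squares are needed because an inversion of an
edge fixes no vertex, while its square does.

Conversely, without such elements the action on vertices is free and there are no involutions.
Choose a connected set `D` of orbit representatives. The elements that carry `D` to a neighbouring
translate generate the group; finitely many suffice, and no two of these need be mutually inverse.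
Each chosen generator or inverse `γ` has an edge from `D` to `γ D`. The far ends of these edges are
distinct and outside `D`, so the half-trees behind them are disjoint and serve as ping-pong tables
avoiding the base vertex. Hence the generators form a basis and the base vertex has trivial
stabiliser, which forces discreteness.

Either alternative has a finite witness: a word and a vertex, or words for the ping-pong generators
with a finite path in `D` through the origins of their edges and expressions for the given
automorphisms. The path can replace `D` in the ping-pong argument, so `D` need not be known to
verify the witness. Asking all questions in turn until the answers confirm some witness is therefore
a decision procedure. -/

namespace TreeAut

/-! ### A search procedure -/

/-- The `k`-th question in a fixed enumeration of all questions. -/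
def queryOf (k : ℕ) : Query :=
  (Encodable.decode (α := Query) k).getD (Sum.inl [])

theorem queryOf_encode (q : Query) : queryOf (Encodable.encode q) = q := by
  simp [queryOf]

/-- The answers recorded in `h` (the latest first), given to the first questions of the enumeration,
contain all the expected answers listed in `l`. -/
def Confirms (h : List Bool) (l : List (Query × Bool)) : Prop :=
  ∀ p ∈ l, h.reverse[Encodable.encode p.1]? = some p.2

theorem primrecRel_confirms : PrimrecRel Confirms := by
  have h : PrimrecRel fun (p : Query × Bool) (h : List Bool) =>
      h.reverse[Encodable.encode p.1]? = some p.2 :=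
    Primrec.eq.comp
      (Primrec.list_getElem?.comp (Primrec.list_reverse.comp Primrec.snd)
        (Primrec.encode.comp (Primrec.fst.comp Primrec.fst)))
      (Primrec.option_some.comp (Primrec.snd.comp Primrec.fst))
  exact h.forall_mem_list.comp Primrec.snd Primrec.fst

section Search

variable {C : Type} [Primcodable C] [Inhabited C]

/-- The certificate examined when `k` answers have been received; every certificate is examined
infinitely often. -/
def certificateAt (C : Type) [Primcodable C] [Inhabited C] (k : ℕ) : C :=
  (Encodable.decode (α := C) k.unpair.1).getD default

theorem certificateAt_pair (c : C) (m : ℕ) :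
    certificateAt C (Nat.pair (Encodable.encode c) m) = c := by
  simp [certificateAt]

open Classical in
/-- Ask all questions one after the other until the answers received confirm a certificate. -/
noncomputable def searchNext (tests : ℕ → C → List (Query × Bool)) (verdict : C → Bool)
    (n : ℕ) (h : List Bool) : Query ⊕ Bool :=
  if Confirms h (tests n (certificateAt C h.length)) then
    Sum.inr (verdict (certificateAt C h.length))
  else Sum.inl (queryOf h.length)

theorem primrec_certificateAt : Primrec (certificateAt C) :=
  Primrec.option_getD_default.comp
    (Primrec.decode.comp (Primrec.fst.comp Primrec.unpair))

theorem primrec_queryOf : Primrec queryOf :=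
  Primrec.option_getD.comp Primrec.decode (Primrec.const _)

theorem computable_searchNext {tests : ℕ → C → List (Query × Bool)} {verdict : C → Bool}
    (ht : Primrec₂ tests) (hv : Primrec verdict) : Computable₂ (searchNext tests verdict) := by
  classical
  refine Primrec.to_comp (α := ℕ × List Bool) ?_
  have hl : Primrec fun p : ℕ × List Bool => p.2.length :=
    Primrec.list_length.comp Primrec.snd
  have hc : Primrec fun p : ℕ × List Bool => certificateAt C p.2.length :=
    primrec_certificateAt.comp hl
  exact Primrec.ite (primrecRel_confirms.comp Primrec.snd (ht.comp Primrec.fst hc))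
    (Primrec.sumInr.comp (hv.comp hc)) (Primrec.sumInl.comp (primrec_queryOf.comp hl))

/-- The algorithm that looks for a certificate confirmed by the answers. -/
noncomputable def searchAlgorithm (tests : ℕ → C → List (Query × Bool)) (verdict : C → Bool)
    (ht : Primrec₂ tests) (hv : Primrec verdict) : Algorithm where
  next := searchNext tests verdict
  computable := computable_searchNext ht hv

/-- The answers to the first `k` questions of the enumeration, the latest first. -/
def fullHistory (ans : Query → Bool) (k : ℕ) : List Bool :=
  ((List.range k).map fun i => ans (queryOf i)).reverse

theorem fullHistory_length (ans : Query → Bool) (k : ℕ) : (fullHistory ans k).length = k := by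
  simp [fullHistory]

theorem fullHistory_succ (ans : Query → Bool) (k : ℕ) :
    fullHistory ans (k + 1) = ans (queryOf k) :: fullHistory ans k := by
  simp [fullHistory, List.range_succ]

theorem ans_eq_of_confirms {ans : Query → Bool} {k : ℕ} {l : List (Query × Bool)}
    (h : Confirms (fullHistory ans k) l) : ∀ p ∈ l, ans p.1 = p.2 := by
  intro p hp
  have := h p hp
  simp only [fullHistory, List.reverse_reverse, List.getElem?_map, Option.map_eq_some_iff] at this
  obtain ⟨i, hi, hi'⟩ := this
  obtain ⟨hk, rfl⟩ := List.getElem?_eq_some_iff.1 hi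
  simpa [queryOf_encode] using hi'

theorem confirms_of_ans_eq {ans : Query → Bool} {k : ℕ} {l : List (Query × Bool)}
    (hl : ∀ p ∈ l, ans p.1 = p.2) (hk : ∀ p ∈ l, Encodable.encode p.1 < k) :
    Confirms (fullHistory ans k) l := by
  intro p hp
  simp [fullHistory, hk p hp, queryOf_encode, hl p hp]

/-- If some certificate is valid, then the search stops, with the verdict of a valid one. -/
theorem searchAlgorithm_outputs {tests : ℕ → C → List (Query × Bool)} {verdict : C → Bool}
    (ht : Primrec₂ tests) (hv : Primrec verdict) (n : ℕ) (ans : Query → Bool)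
    (hc : ∃ c, ∀ p ∈ tests n c, ans p.1 = p.2) :
    ∃ c, (∀ p ∈ tests n c, ans p.1 = p.2) ∧
      (searchAlgorithm tests verdict ht hv).Outputs n ans (verdict c) := by
  classical
  let P : ℕ → Prop := fun k => Confirms (fullHistory ans k) (tests n (certificateAt C k))
  have hP : ∃ k, P k := by
    obtain ⟨c, hc⟩ := hc
    obtain ⟨m, hm⟩ : ∃ m, ∀ p ∈ tests n c, Encodable.encode p.1 < m := by
      refine ⟨((tests n c).map fun p => Encodable.encode p.1).sum + 1, fun p hp => ?_⟩
      exact Nat.lt_succ_of_le (List.le_sum_of_mem (List.mem_map_of_mem hp))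
    -- This round examines `c`. A pairing is at least its second component, so every question with
    -- code below `m` has been answered by then.
    refine ⟨Nat.pair (Encodable.encode c) m, ?_⟩
    show Confirms _ _
    rw [certificateAt_pair]
    exact confirms_of_ans_eq hc fun p hp => (hm p hp).trans_le (Nat.right_le_pair _ _)
  -- No verdict is given before the first success, so up to that round the questions follow the
  -- enumeration.
  have hist : ∀ k ≤ Nat.find hP,
      (searchAlgorithm tests verdict ht hv).history n ans k = fullHistory ans k := by
    intro k
    induction k with
    | zero => intro _; rfl
    | succ k ih =>
      intro hk
      have hn : (searchAlgorithm tests verdict ht hv).next n (fullHistory ans k) =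
          Sum.inl (queryOf k) := by
        have : ¬ P k := Nat.find_min hP hk
        simp only [searchAlgorithm, searchNext, fullHistory_length]
        exact if_neg this
      rw [Algorithm.history, ih (Nat.le_of_succ_le hk), hn, fullHistory_succ]
  refine ⟨certificateAt C (Nat.find hP), ans_eq_of_confirms (Nat.find_spec hP), Nat.find hP, ?_⟩
  rw [hist _ le_rfl]
  simp only [searchAlgorithm, searchNext, fullHistory_length]
  exact if_pos (Nat.find_spec hP)

end Search

/-! ### Certificates -/

/-- A word, with an edge from a vertex on a given path: the position of the vertex on the path and
the position of the other end of the edge in the list of neighbours. -/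
abbrev Half := Word × (ℕ × ℕ)

/-- A path from the base vertex, pairs of mutually inverse words with associated edges leaving the
path, and, for each given automorphism, an expression by these words. -/
abbrev PingPongCertificate := List ℕ × List (Half × Half) × List Word

/-- A name for the vertex at position `j` of a path, counted from the end. -/
def pathName (a : List ℕ) (j : ℕ) : VertexName :=
  (a.drop j).map Sum.inl

/-- The half of a pair that belongs to a letter. -/
def half (E : List (Half × Half)) (l : Letter) : Half :=
  bif l.2 then (E.getD l.1 default).1 else (E.getD l.1 default).2

/-- The inverse letter. -/
def invLetter (l : Letter) : Letter := (l.1, !l.2)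

/-- The letters in the first `m` generators. -/
def letters (m : ℕ) : List Letter :=
  (List.range m).flatMap fun i => [(i, true), (i, false)]

/-- The end on the path of the edge that belongs to a letter. -/
def originName (a : List ℕ) (E : List (Half × Half)) (l : Letter) : VertexName :=
  pathName a (half E l).2.1

/-- The end off the path of the edge that belongs to a letter. -/
def targetName (a : List ℕ) (E : List (Half × Half)) (l : Letter) : VertexName :=
  Sum.inl (half E l).2.2 :: originName a E l

/-- Substitution of words for the letters of a word. -/
def substWord (E : List (Half × Half)) (z : Word) : Word :=
  z.flatMap fun l => (half E l).1

/-- The answers that confirm a ping-pong certificate. -/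
def pingPongTests (n : ℕ) (c : PingPongCertificate) : List (Query × Bool) :=
  (letters c.2.1.length).map (fun l =>
    (Sum.inl ((half c.2.1 l).1 ++ (half c.2.1 (invLetter l)).1), true)) ++
  ((letters c.2.1.length).map (fun l =>
    (Sum.inr ((half c.2.1 l).1.map Sum.inr ++ originName c.1 c.2.1 (invLetter l),
      targetName c.1 c.2.1 l), true)) ++
  ((letters c.2.1.length).flatMap (fun l => (List.range (c.1.length + 1)).map fun j =>
    (Sum.inr (targetName c.1 c.2.1 l, pathName c.1 j), false)) ++
  ((letters c.2.1.length).flatMap (fun l => (letters c.2.1.length).map fun l' =>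
    (Sum.inr (targetName c.1 c.2.1 l, targetName c.1 c.2.1 l'), decide (l = l'))) ++
  (List.range n).map (fun i =>
    (Sum.inl (substWord c.2.1 (c.2.2.getD i []) ++ [(i, false)]), true)))))

/-- The answers that show that a word is nontrivial and that its square fixes a vertex. -/
def ellipticTests (c : Word × VertexName) : List (Query × Bool) :=
  [(Sum.inl c.1, false), (Sum.inr (c.1.map Sum.inr ++ (c.1.map Sum.inr ++ c.2), c.2), true)]

/-- Certificates for either verdict. -/
abbrev Certificate := (Word × VertexName) ⊕ PingPongCertificate

/-- The answers that confirm a certificate. -/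
def tests (n : ℕ) (c : Certificate) : List (Query × Bool) :=
  Sum.elim ellipticTests (pingPongTests n) c

/-- The verdict that a certificate supports. -/
def verdict (c : Certificate) : Bool :=
  Sum.elim (fun _ => false) (fun _ => true) c

/-! ### Computability of the tests -/

section Computability

open Primrec

theorem primrec_pathName : Primrec₂ pathName :=
  list_map (list_drop.comp snd fst) (sumInl.comp snd).to₂

theorem primrec_half : Primrec₂ half := by
  have h : Primrec fun p : List (Half × Half) × Letter => p.1.getD p.2.1 default :=
    (list_getD _).comp fst (fst.comp snd)
  exact Primrec.cond (snd.comp snd) (fst.comp h) (snd.comp h)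

theorem primrec_invLetter : Primrec invLetter :=
  Primrec.pair fst (Primrec.not.comp snd)

theorem primrec_letters : Primrec letters := by
  refine list_flatMap list_range ?_
  exact list_cons.comp (Primrec.pair snd (const true))
    (list_cons.comp (Primrec.pair snd (const false)) (const []))

theorem primrec_substWord : Primrec₂ substWord :=
  list_flatMap snd (fst.comp (primrec_half.comp (fst.comp fst) snd)).to₂

variable {α : Type} [Primcodable α] {a : α → List ℕ} {E : α → List (Half × Half)} {l : α → Letter}

theorem primrec_originName (ha : Primrec a) (hE : Primrec E) (hl : Primrec l) :
    Primrec fun x => originName (a x) (E x) (l x) :=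
  primrec_pathName.comp ha (fst.comp (snd.comp (primrec_half.comp hE hl)))

theorem primrec_targetName (ha : Primrec a) (hE : Primrec E) (hl : Primrec l) :
    Primrec fun x => targetName (a x) (E x) (l x) :=
  list_cons.comp (sumInl.comp (snd.comp (snd.comp (primrec_half.comp hE hl))))
    (primrec_originName ha hE hl)

theorem primrec_wordSteps : Primrec fun w : Word => (w.map Sum.inr : VertexName) :=
  list_map Primrec.id (sumInr.comp snd).to₂

theorem primrec_pingPongTests : Primrec₂ pingPongTests := by
  have hE : Primrec fun p : ℕ × PingPongCertificate => p.2.2.1 := fst.comp (snd.comp snd)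
  have ha : Primrec fun p : ℕ × PingPongCertificate => p.2.1 := fst.comp snd
  have hZ : Primrec fun p : ℕ × PingPongCertificate => p.2.2.2 := snd.comp (snd.comp snd)
  have hl : Primrec fun p : ℕ × PingPongCertificate => letters p.2.2.1.length :=
    primrec_letters.comp (list_length.comp hE)
  have hE1 : Primrec fun p : (ℕ × PingPongCertificate) × Letter => p.1.2.2.1 := hE.comp fst
  have ha1 : Primrec fun p : (ℕ × PingPongCertificate) × Letter => p.1.2.1 := ha.comp fst
  have hy : Primrec fun p : (ℕ × PingPongCertificate) × Letter => (half p.1.2.2.1 p.2).1 :=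
    fst.comp (primrec_half.comp hE1 snd)
  have hi : Primrec fun p : (ℕ × PingPongCertificate) × Letter => invLetter p.2 :=
    primrec_invLetter.comp snd
  have hu : Primrec fun p : (ℕ × PingPongCertificate) × Letter =>
      targetName p.1.2.1 p.1.2.2.1 p.2 := primrec_targetName ha1 hE1 snd
  refine list_append.comp (list_map hl ?_) (list_append.comp (list_map hl ?_)
    (list_append.comp (list_flatMap hl ?_) (list_append.comp (list_flatMap hl ?_)
      (list_map (list_range.comp fst) ?_))))
  · exact Primrec.pair (sumInl.comp (list_append.comp hy
      (fst.comp (primrec_half.comp hE1 hi)))) (const true)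
  · exact Primrec.pair (sumInr.comp (Primrec.pair (list_append.comp (primrec_wordSteps.comp hy)
      (primrec_originName ha1 hE1 hi)) hu)) (const true)
  · refine list_map (list_range.comp (succ.comp (list_length.comp ha1))) ?_
    exact Primrec.pair (sumInr.comp (Primrec.pair (hu.comp fst)
      (primrec_pathName.comp (ha1.comp fst) snd))) (const false)
  · refine list_map (hl.comp fst) ?_
    refine Primrec.pair (sumInr.comp (Primrec.pair (hu.comp fst)
      (primrec_targetName (ha1.comp fst) (hE1.comp fst) snd))) ?_
    exact (Primrec.eq (α := Letter)).decide.comp (snd.comp fst) snd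
  · refine Primrec.pair (sumInl.comp (list_append.comp (primrec_substWord.comp (hE.comp fst)
      ((list_getD []).comp (hZ.comp fst) snd)) ?_)) (const true)
    exact list_cons.comp (Primrec.pair snd (const false)) (const [])

theorem primrec_ellipticTests : Primrec ellipticTests := by
  have hw : Primrec fun c : Word × VertexName => (c.1.map Sum.inr : VertexName) :=
    primrec_wordSteps.comp fst
  refine list_cons.comp (Primrec.pair (sumInl.comp fst) (const false))
    (list_cons.comp (Primrec.pair (sumInr.comp (Primrec.pair ?_ snd)) (const true)) (const []))
  exact list_append.comp hw (list_append.comp hw snd)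

theorem primrec_tests : Primrec₂ tests := by
  refine (sumCasesOn (f := fun p : ℕ × Certificate => p.2) snd
    (primrec_ellipticTests.comp snd).to₂
    (primrec_pingPongTests.comp (fst.comp fst) snd).to₂).of_eq ?_
  rintro ⟨n, c | c⟩ <;> rfl

theorem primrec_verdict : Primrec verdict := by
  refine (sumCasesOn (f := fun c : Certificate => c) Primrec.id
    (const false).to₂ (const true).to₂).of_eq ?_
  rintro (c | c) <;> rfl

end Computability

/-! ### Meaning of the tests -/

section Meaning

variable {V : Type*} {T : SimpleGraph V} {v₀ : V} {nbrs : V → List V} {L : List (T ≃g T)}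

theorem evalWord_append (w w' : Word) : evalWord L (w ++ w') = evalWord L w * evalWord L w' := by
  simp [evalWord]

theorem evalWord_cons (a : Letter) (w : Word) :
    evalWord L (a :: w) = evalLetter L a * evalWord L w := by
  simp [evalWord]

theorem evalLetter_invLetter (a : Letter) :
    evalLetter L (invLetter a) = (evalLetter L a)⁻¹ := by
  rcases a with ⟨i, _ | _⟩ <;> simp [evalLetter, invLetter]

theorem evalVertex_append (w : Word) (p : VertexName) :
    evalVertex v₀ nbrs L (w.map Sum.inr ++ p) = evalWord L w (evalVertex v₀ nbrs L p) := by
  induction w with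
  | nil => rfl
  | cons a w ih =>
    rw [evalWord_cons, RelIso.mul_apply, ← ih]
    rfl

theorem answer_word (w : Word) : answer v₀ nbrs L (Sum.inl w) = true ↔ evalWord L w = 1 := by
  simp [answer]

theorem answer_vertex (p q : VertexName) : answer v₀ nbrs L (Sum.inr (p, q)) = true ↔
    evalVertex v₀ nbrs L p = evalVertex v₀ nbrs L q := by
  simp [answer]

theorem mem_letters {m : ℕ} {l : Letter} : l ∈ letters m ↔ l.1 < m := by
  rcases l with ⟨i, _ | _⟩ <;> simp [letters]

theorem ellipticTests_iff (w : Word) (p : VertexName) :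
    (∀ t ∈ ellipticTests (w, p), answer v₀ nbrs L t.1 = t.2) ↔
      evalWord L w ≠ 1 ∧ evalWord L w (evalWord L w (evalVertex v₀ nbrs L p)) =
        evalVertex v₀ nbrs L p := by
  simp only [ellipticTests, List.mem_cons, List.not_mem_nil, or_false, forall_eq_or_imp,
    forall_eq, answer_vertex, evalVertex_append]
  rw [ne_eq, ← answer_word (v₀ := v₀) (nbrs := nbrs) w, Bool.not_eq_true]

/-- The five clauses are the hypotheses of ping-pong: inverse pairs, edges turned around onto each
other, far ends off the path, far ends distinct, and generation of the given automorphisms.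
Soundness and completeness then both argue in the tree alone. -/
theorem pingPongTests_iff (n : ℕ) (a : List ℕ) (E : List (Half × Half)) (Z : List Word) :
    (∀ t ∈ pingPongTests n (a, E, Z), answer v₀ nbrs L t.1 = t.2) ↔
      (∀ l : Letter, l.1 < E.length →
        evalWord L (half E l).1 * evalWord L (half E (invLetter l)).1 = 1) ∧
      (∀ l : Letter, l.1 < E.length →
        evalWord L (half E l).1 (evalVertex v₀ nbrs L (originName a E (invLetter l))) =
          evalVertex v₀ nbrs L (targetName a E l)) ∧
      (∀ l : Letter, l.1 < E.length → ∀ j ≤ a.length,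
        evalVertex v₀ nbrs L (targetName a E l) ≠ evalVertex v₀ nbrs L (pathName a j)) ∧
      (∀ l l' : Letter, l.1 < E.length → l'.1 < E.length →
        evalVertex v₀ nbrs L (targetName a E l) = evalVertex v₀ nbrs L (targetName a E l') →
          l = l') ∧
      (∀ i < n, evalWord L (substWord E (Z.getD i [])) = L.getD i 1) := by
  simp only [pingPongTests, List.forall_mem_append]
  refine and_congr ?_ (and_congr ?_ (and_congr ?_ (and_congr ?_ ?_)))
  · simp only [List.forall_mem_map, mem_letters, answer_word, evalWord_append]
  · simp only [List.forall_mem_map, mem_letters, answer_vertex, evalVertex_append]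
  · simp only [List.forall_mem_flatMap, List.forall_mem_map, mem_letters, List.mem_range,
      ← Bool.not_eq_true, answer_vertex, Nat.lt_succ_iff, ne_eq]
  · simp only [List.forall_mem_flatMap, List.forall_mem_map, mem_letters]
    refine forall_congr' fun l => ⟨fun h l' hl hl' he => ?_, fun h hl l' hl' => ?_⟩
    · have := h hl l' hl'
      rw [(answer_vertex _ _).2 he] at this
      exact of_decide_eq_true this.symm
    · rw [Bool.eq_iff_iff, answer_vertex, decide_eq_true_iff]
      exact ⟨h l' hl hl', fun e => by rw [e]⟩
  · simp only [List.forall_mem_map, List.mem_range, answer_word, evalWord_append]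
    refine forall₂_congr fun i _ => ?_
    rw [mul_eq_one_iff_eq_inv]
    simp [evalWord, evalLetter]

end Meaning

open Relation

/-! ### Half-trees and ping-pong -/

section HalfTree

variable {V : Type*} {T : SimpleGraph V}

/-- The vertices that can be reached from `u` without crossing the edge between `o` and `u`. -/
def halfTree (T : SimpleGraph V) (o u : V) : Set V :=
  {v | ReflTransGen (fun a b => T.Adj a b ∧ s(a, b) ≠ s(o, u)) u v}

theorem right_mem_halfTree (o u : V) : u ∈ halfTree T o u := ReflTransGen.refl

/-- Every edge of an acyclic graph is a bridge. -/
theorem left_notMem_halfTree (hT : T.IsAcyclic) {o u : V} (h : T.Adj o u) :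
    o ∉ halfTree T o u := by
  intro ho
  have hb := SimpleGraph.isBridge_iff.1 (SimpleGraph.isAcyclic_iff_forall_adj_isBridge.1 hT h)
  refine hb (SimpleGraph.Reachable.symm ?_)
  rw [SimpleGraph.reachable_iff_reflTransGen]
  refine ReflTransGen.mono (fun a b hab => ?_) _ _ ho
  rw [SimpleGraph.deleteEdges_adj]
  exact ⟨hab.1, by simpa using hab.2⟩

/-- The only edge into a half-tree is the one that defines it. -/
theorem eq_of_adj_of_notMem_halfTree (hT : T.IsAcyclic) {o u a b : V} (h : T.Adj o u)
    (hab : T.Adj a b) (ha : a ∉ halfTree T o u) (hb : b ∈ halfTree T o u) : a = o ∧ b = u := by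
  by_cases he : s(b, a) = s(o, u)
  · rcases Sym2.eq_iff.1 he with ⟨rfl, rfl⟩ | ⟨rfl, rfl⟩
    · exact absurd hb (left_notMem_halfTree hT h)
    · exact ⟨rfl, rfl⟩
  · exact absurd (ReflTransGen.tail hb ⟨hab.symm, he⟩) ha

theorem mem_of_closed_of_connected (hT : T.Connected) {S : Set V} {s : V} (hs : s ∈ S)
    (h : ∀ a b, T.Adj a b → a ∈ S → b ∈ S) (v : V) : v ∈ S := by
  have := (SimpleGraph.reachable_iff_reflTransGen _ _).1 (hT.preconnected s v)
  induction this with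
  | refl => exact hs
  | tail _ hab ih => exact h _ _ hab ih

/-- The union of the two sides is closed under adjacency: a step across the edge arrives at one of
its ends, and any other step stays on its side. -/
theorem mem_halfTree_or_mem_halfTree (hT : T.Connected) (o u v : V) :
    v ∈ halfTree T o u ∨ v ∈ halfTree T u o := by
  refine mem_of_closed_of_connected hT (S := halfTree T o u ∪ halfTree T u o)
    (Or.inl (right_mem_halfTree o u)) (fun a b hab ha => ?_) v
  by_cases he : s(a, b) = s(o, u)
  · rcases Sym2.eq_iff.1 he with ⟨rfl, rfl⟩ | ⟨rfl, rfl⟩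
    · exact Or.inl (right_mem_halfTree _ _)
    · exact Or.inr (right_mem_halfTree _ _)
  · rcases ha with ha | ha
    · exact Or.inl (ReflTransGen.tail ha ⟨hab, he⟩)
    · exact Or.inr (ReflTransGen.tail ha ⟨hab, fun h => he (h.trans Sym2.eq_swap)⟩)

theorem map_mem_halfTree (g : T ≃g T) {o u v : V} (h : v ∈ halfTree T o u) :
    g v ∈ halfTree T (g o) (g u) := by
  refine ReflTransGen.lift g (fun a b hab => ⟨g.map_rel_iff.2 hab.1, fun he => hab.2 ?_⟩) _ _ h
  rw [← Sym2.map_mk, ← Sym2.map_mk] at he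
  exact Sym2.map.injective g.injective he

/-- An automorphism that turns one edge around onto another maps the complement of a half-tree into
a half-tree. -/
theorem map_mem_halfTree_of_notMem (hT : T.Connected) (g : T ≃g T) {o u o' u' v : V}
    (ho : g o' = u) (hu : g u' = o) (h : v ∉ halfTree T o' u') : g v ∈ halfTree T o u := by
  rw [← ho, ← hu]
  -- The complement lies in the half-tree on the side of `o'`, whose edge is carried to the one from
  -- `o` to `u`.
  exact map_mem_halfTree g ((mem_halfTree_or_mem_halfTree hT o' u' v).resolve_left h)

/-- Every vertex in `D` can be reached from `v₀` inside `D`. -/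
def ConnectedFrom (T : SimpleGraph V) (v₀ : V) (D : Set V) : Prop :=
  ∀ v ∈ D, ReflTransGen (fun a b => T.Adj a b ∧ b ∈ D) v₀ v

/-- A half-tree attached to a subtree does not meet it. -/
theorem notMem_halfTree_of_connectedFrom (hT : T.IsAcyclic) {v₀ : V} {D : Set V}
    (hD : ConnectedFrom T v₀ D) (hv₀ : v₀ ∈ D) {o u : V} (h : T.Adj o u) (ho : o ∈ D)
    (hu : u ∉ D) : ∀ v ∈ D, v ∉ halfTree T o u := by
  -- The only edge between the half-tree and its complement ends at `u ∉ D`, so a walk inside `D`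
  -- never changes sides.
  have key : ∀ v, ReflTransGen (fun a b => T.Adj a b ∧ b ∈ D) v₀ v →
      (v₀ ∈ halfTree T o u ↔ v ∈ halfTree T o u) ∧ v ∈ D := by
    intro v hv
    induction hv with
    | refl => exact ⟨Iff.rfl, hv₀⟩
    | @tail b c _ hbc ih =>
      refine ⟨ih.1.trans ⟨fun hb => ?_, fun hc => ?_⟩, hbc.2⟩ <;> by_contra hn
      · exact hu ((eq_of_adj_of_notMem_halfTree hT h hbc.1.symm hn hb).2 ▸ ih.2)
      · exact hu ((eq_of_adj_of_notMem_halfTree hT h hbc.1 hn hc).2 ▸ hbc.2)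
  intro v hv hvH
  have h1 := (key v (hD v hv)).1.2 hvH
  exact left_notMem_halfTree hT h ((key o (hD o ho)).1.1 h1)

/-- Half-trees attached to a subtree along different edges are disjoint. -/
theorem disjoint_halfTree_of_connectedFrom (hT : T.IsTree) {v₀ : V} {D : Set V}
    (hD : ConnectedFrom T v₀ D) (hv₀ : v₀ ∈ D) {o u o' u' : V} (h : T.Adj o u) (ho : o ∈ D)
    (hu : u ∉ D) (h' : T.Adj o' u') (ho' : o' ∈ D) (hu' : u' ∉ D) (hne : u ≠ u') :
    Disjoint (halfTree T o u) (halfTree T o' u') := by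
  have hA := hT.isAcyclic
  have hn := notMem_halfTree_of_connectedFrom hA hD hv₀ h ho hu
  have hn' := notMem_halfTree_of_connectedFrom hA hD hv₀ h' ho' hu'
  rw [Set.disjoint_left]
  intro x hx hx'
  -- A nonempty intersection would be closed under adjacency and so contain `v₀`. Indeed, an exit
  -- crosses a defining edge, and either its origin, a vertex of `D`, lies in the other half-tree,
  -- or both edges are crossed at once and `u = u'`.
  refine hn v₀ hv₀ (mem_of_closed_of_connected hT.connected
    (S := halfTree T o u ∩ halfTree T o' u') ⟨hx, hx'⟩ (fun a b hab ha => ?_) v₀).1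
  by_contra hb
  by_cases hb1 : b ∈ halfTree T o u
  · obtain ⟨rfl, rfl⟩ := eq_of_adj_of_notMem_halfTree hA h' hab.symm (fun hb2 => hb ⟨hb1, hb2⟩) ha.2
    exact hn _ ho' hb1
  · obtain ⟨rfl, rfl⟩ := eq_of_adj_of_notMem_halfTree hA h hab.symm hb1 ha.1
    by_cases hb2 : b ∈ halfTree T o' u'
    · exact hn' _ ho hb2
    · exact hne (eq_of_adj_of_notMem_halfTree hA h' hab.symm hb2 ha.2).2

end HalfTree

section PingPong

variable {ι G V : Type*} [Group G] [MulAction G V]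

/-- Ping-pong, with a base point outside all tables: a nontrivial word moves the base point. -/
theorem eq_one_of_lift_smul_eq (f : ι → G) (U : ι × Bool → Set V) (v₀ : V)
    (hv₀ : ∀ l, v₀ ∉ U l) (hU : ∀ l l', l ≠ l' → Disjoint (U l) (U l'))
    (hf : ∀ i, ∀ v ∉ U (i, false), f i • v ∈ U (i, true))
    (hf' : ∀ i, ∀ v ∉ U (i, true), (f i)⁻¹ • v ∈ U (i, false))
    {x : FreeGroup ι} (hx : FreeGroup.lift f x • v₀ = v₀) : x = 1 := by
  classical
  have step : ∀ l : ι × Bool, ∀ v ∉ U (l.1, !l.2),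
      (bif l.2 then f l.1 else (f l.1)⁻¹) • v ∈ U l := by
    rintro ⟨i, _ | _⟩ v hv
    · exact hf' i v hv
    · exact hf i v hv
  -- The first letter of a reduced word names the table that receives `v₀`. The next letter is not
  -- its inverse, so the table of that letter avoids the only one on which the first letter is
  -- uncontrolled.
  have key : ∀ (w : List (ι × Bool)) (l : ι × Bool), FreeGroup.IsReduced (l :: w) →
      ((l :: w).map fun x => bif x.2 then f x.1 else (f x.1)⁻¹).prod • v₀ ∈ U l := by
    intro w
    induction w with
    | nil =>
      intro l _
      simpa using step l v₀ (hv₀ _)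
    | cons l' w ih =>
      intro l hl
      rw [List.map_cons, List.prod_cons, mul_smul]
      rw [FreeGroup.isReduced_cons_cons] at hl
      refine step l _ fun hm => ?_
      refine Set.disjoint_left.1 (hU l' (l.1, !l.2) ?_) (ih l' hl.2) hm
      rintro rfl
      simpa using hl.1 rfl
  rw [← FreeGroup.toWord_eq_nil_iff]
  cases hw : x.toWord with
  | nil => rfl
  | cons l w =>
    have := key w l (hw ▸ FreeGroup.isReduced_toWord)
    rw [← FreeGroup.lift_mk, ← hw, FreeGroup.mk_toWord, hx] at this
    exact absurd this (hv₀ l)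

end PingPong

/-! ### Discreteness -/

section Discrete

variable {V : Type*} {T : SimpleGraph V}

open Classical in
/-- A vertex as a point of the realisation. -/
noncomputable def vertexPoint (T : SimpleGraph V) (a : V) : realization T :=
  ⟨fun v => if v = a then 1 else 0, fun v => by
    show (0 : ℝ) ≤ if v = a then 1 else 0
    split_ifs <;> norm_num,
    ⟨a, a, Or.inl rfl, fun v hv => by simpa using hv⟩, by
      rw [finsum_eq_single _ a fun v hv => if_neg hv, if_pos rfl]⟩

theorem realizationMap_vertexPoint_pos (g : T ≃g T) (a b : V) :
    0 < (realizationMap T g (vertexPoint T a)).1 b ↔ g a = b := by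
  have : (realizationMap T g (vertexPoint T a)).1 b = (vertexPoint T a).1 (g.symm b) := rfl
  rw [this, vertexPoint]
  by_cases h : g.symm b = a
  · simp [← h]
  · simp only [h, if_false, lt_irrefl, false_iff]
    rintro rfl
    exact h (g.symm_apply_apply a)

theorem isOpen_setOf_apply_eq (a b : V) :
    @IsOpen _ (compactOpenTopology T) {g : T ≃g T | g a = b} := by
  -- That `a` goes to `b` is seen from a positive coordinate at `b`, an open condition.
  have ho : IsOpen {f : C(realization T, realization T) | 0 < (f (vertexPoint T a)).1 b} := by
    refine isOpen_lt continuous_const ?_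
    exact (continuous_apply b).comp
      (continuous_subtype_val.comp (continuous_eval_const (vertexPoint T a)))
  refine ⟨_, ho, ?_⟩
  ext g
  exact realizationMap_vertexPoint_pos g a b

/-- A group of automorphisms in which the stabiliser of some vertex is trivial is discrete. -/
theorem isDiscreteSubgroup_of_stabilizer {G : Subgroup (T ≃g T)} (v₀ : V)
    (h : ∀ g ∈ G, g v₀ = v₀ → g = 1) : IsDiscreteSubgroup T G := by
  let _ := compactOpenTopology T
  refine discreteTopology_iff_isOpen_singleton.2 fun g => ?_
  -- Within the group this is the coset of `g` by the trivial stabiliser of `v₀`.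
  refine ⟨{k | k v₀ = g.1 v₀}, isOpen_setOf_apply_eq v₀ (g.1 v₀), ?_⟩
  ext k
  refine ⟨fun hk => ?_, fun hk => by rw [hk]; rfl⟩
  have hk' : k.1 v₀ = g.1 v₀ := hk
  have := h (g.1⁻¹ * k.1) (G.mul_mem (G.inv_mem g.2) k.2) (by
    rw [RelIso.mul_apply, hk', ← RelIso.mul_apply, inv_mul_cancel, RelIso.one_apply])
  exact Subtype.ext (inv_mul_eq_one.1 this).symm

/-- An open set of maps contains with a map all those that agree with it on a suitable compact
set. -/
theorem exists_isCompact_of_isOpen {X Y : Type*} [TopologicalSpace X] [TopologicalSpace Y]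
    {O : Set C(X, Y)} (hO : IsOpen O) :
    ∀ f ∈ O, ∃ K, IsCompact K ∧ ∀ f' : C(X, Y), Set.EqOn f f' K → f' ∈ O := by
  -- The topology is by definition generated by these sets. The property holds for them and survives
  -- finite intersections (union of compact sets) and arbitrary unions.
  have hO' : TopologicalSpace.GenerateOpen
      (Set.image2 (fun (K : Set X) (U : Set Y) => {f : C(X, Y) | Set.MapsTo f K U})
        {K | IsCompact K} {U | IsOpen U}) O := hO
  induction hO' with
  | basic s hs =>
    obtain ⟨K, hK, U, -, rfl⟩ := hs
    exact fun f hf => ⟨K, hK, fun f' hff' x hx => hff' hx ▸ hf hx⟩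
  | univ => exact fun f _ => ⟨∅, isCompact_empty, fun _ _ => trivial⟩
  | inter s t hs ht ihs iht =>
    intro f hf
    obtain ⟨K, hK, h⟩ := ihs hs f hf.1
    obtain ⟨K', hK', h'⟩ := iht ht f hf.2
    exact ⟨K ∪ K', hK.union hK', fun f' hff' =>
      ⟨h f' (hff'.mono Set.subset_union_left), h' f' (hff'.mono Set.subset_union_right)⟩⟩
  | sUnion S hS ih =>
    rintro f ⟨s, hs, hfs⟩
    obtain ⟨K, hK, h⟩ := ih s hs (hS s hs) f hfs
    exact ⟨K, hK, fun f' hff' => ⟨s, hs, h f' hff'⟩⟩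

/-- The points of a compact subset of the realisation of a locally finite graph have their supports
in a common finite set. -/
theorem exists_finite_support_of_isCompact (hT : ∀ v, (T.neighborSet v).Finite)
    {K : Set (realization T)} (hK : IsCompact K) :
    ∃ F : Set V, F.Finite ∧ ∀ p ∈ K, Function.support p.1 ⊆ F := by
  -- Total weight 1 makes some coordinate of each point nonzero, so these open sets cover. A support
  -- within one edge lies in the closed neighbourhood of any vertex it contains.
  obtain ⟨t, ht⟩ := hK.elim_finite_subcover (fun v : V => {p : realization T | p.1 v ≠ 0})
    (fun v => isOpen_ne_fun ((continuous_apply v).comp continuous_subtype_val) continuous_const) (by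
      intro p _
      by_contra hn
      have h0 : ∀ v, p.1 v = 0 := fun v => by
        by_contra hv
        exact hn (Set.mem_iUnion.2 ⟨v, hv⟩)
      have h1 := p.2.2.2
      simp [h0] at h1)
  refine ⟨⋃ v ∈ t, insert v (T.neighborSet v),
    t.finite_toSet.biUnion fun v _ => (hT v).insert v, fun p hp w hw => ?_⟩
  obtain ⟨v, hv, hpv⟩ := Set.mem_iUnion₂.1 (ht hp)
  refine Set.mem_iUnion₂.2 ⟨v, hv, ?_⟩
  obtain ⟨a, b, hab, hs⟩ := p.2.2.1
  have hv' := hs hpv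
  have hw' := hs hw
  simp only [Set.mem_insert_iff, Set.mem_singleton_iff] at hv' hw'
  rw [Set.mem_insert_iff, SimpleGraph.mem_neighborSet]
  rcases hab with rfl | hab <;> rcases hv' with rfl | rfl <;> rcases hw' with rfl | rfl <;>
    simp [*, SimpleGraph.Adj.symm]

/-- In a discrete group of automorphisms, only the identity fixes all vertices of a suitable finite
set. -/
theorem exists_finite_pointwise_stabilizer (hT : ∀ v, (T.neighborSet v).Finite)
    {G : Subgroup (T ≃g T)} (hG : IsDiscreteSubgroup T G) :
    ∃ F : Set V, F.Finite ∧ ∀ g ∈ G, (∀ v ∈ F, g v = v) → g = 1 := by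
  let _ := compactOpenTopology T
  obtain ⟨s, ⟨O, hO, rfl⟩, hs⟩ := discreteTopology_iff_isOpen_singleton.1 hG 1
  have h1 : (1 : G) ∈ ({1} : Set G) := rfl
  rw [← hs] at h1
  obtain ⟨K, hK, hKO⟩ := exists_isCompact_of_isOpen hO _ h1
  obtain ⟨F, hF, hFK⟩ := exists_finite_support_of_isCompact hT hK
  refine ⟨F, hF, fun g hg hgF => ?_⟩
  have : (⟨g, hg⟩ : G) ∈ ({1} : Set G) := by
    rw [← hs]
    refine hKO _ fun p hp => Subtype.ext (funext fun v => ?_)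
    show p.1 v = p.1 (g.symm v)
    -- The weight vanishes outside `F`, and `g`, fixing `F` pointwise, preserves its complement.
    by_cases hv : v ∈ F
    · rw [show g.symm v = v from g.injective ((g.apply_symm_apply v).trans (hgF v hv).symm)]
    · by_cases hv' : g.symm v ∈ F
      · have := hgF _ hv'
        rw [g.apply_symm_apply] at this
        exact absurd (this ▸ hv') hv
      · rw [Function.notMem_support.1 fun h => hv (hFK p hp h),
          Function.notMem_support.1 fun h => hv' (hFK p hp h)]
  exact congrArg Subtype.val (Set.mem_singleton_iff.1 this)

/-- If an automorphism of a connected locally finite graph fixes a vertex, then some power fixes any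
other given vertex. -/
theorem exists_pow_apply_eq (hc : T.Connected) (hT : ∀ v, (T.neighborSet v).Finite) {g : T ≃g T}
    {v : V} (hv : g v = v) (w : V) : ∃ k, 0 < k ∧ (g ^ k) w = w := by
  refine mem_of_closed_of_connected hc (S := {w | ∃ k, 0 < k ∧ (g ^ k) w = w})
    ⟨1, one_pos, by simpa using hv⟩ (fun a b hab ha => ?_) w
  obtain ⟨k, hk, hka⟩ := ha
  have hfix : ∀ j : ℕ, ((g ^ k) ^ j) a = a := by
    intro j
    induction j with
    | zero => rfl
    | succ j ih => rw [pow_succ, RelIso.mul_apply, hka, ih]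
  -- The powers of `g ^ k` fix `a`, so they send `b` into a finite set, and two of them agree at
  -- `b`.
  have hmaps : Set.MapsTo (fun j : ℕ => ((g ^ k) ^ j) b) Set.univ (T.neighborSet a) := by
    intro j _
    have : T.Adj (((g ^ k) ^ j) a) (((g ^ k) ^ j) b) :=
      ((g ^ k) ^ j : T ≃g T).map_rel_iff.2 hab
    rwa [hfix] at this
  obtain ⟨i, -, j, -, hij, he⟩ :=
    Set.infinite_univ.exists_ne_map_eq_of_mapsTo hmaps (hT a)
  have aux : ∀ i j : ℕ, i < j → ((g ^ k) ^ i) b = ((g ^ k) ^ j) b →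
      ∃ k, 0 < k ∧ (g ^ k) b = b := by
    intro i j hij he
    refine ⟨k * (j - i), Nat.mul_pos hk (Nat.sub_pos_of_lt hij), ?_⟩
    rw [pow_mul]
    apply ((g ^ k) ^ i : T ≃g T).injective
    rw [← RelIso.mul_apply, ← pow_add, Nat.add_sub_cancel' hij.le, he]
  rcases lt_or_gt_of_ne hij with h | h
  · exact aux i j h he
  · exact aux j i h he.symm

/-- In a discrete and free group of automorphisms, no nontrivial element fixes a vertex. -/
theorem eq_one_of_apply_eq_of_isDiscreteSubgroup (hc : T.Connected)
    (hT : ∀ v, (T.neighborSet v).Finite) {G : Subgroup (T ≃g T)} (hG : IsDiscreteSubgroup T G)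
    [IsMulTorsionFree G] {g : T ≃g T} (hg : g ∈ G) {v : V} (hv : g v = v) : g = 1 := by
  obtain ⟨F, hF, hFG⟩ := exists_finite_pointwise_stabilizer hT hG
  choose k hk hkv using exists_pow_apply_eq hc hT hv
  have hpow : ∀ (w : V) (j : ℕ), ((g ^ k w) ^ j) w = w := by
    intro w j
    induction j with
    | zero => rfl
    | succ j ih => rw [pow_succ, RelIso.mul_apply, hkv, ih]
  -- The exponent is a multiple of every `k w` with `w ∈ F`, so this power fixes `F` pointwise.
  have h1 : g ^ (∏ w ∈ hF.toFinset, k w) = 1 := by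
    refine hFG _ (G.pow_mem hg _) fun w hw => ?_
    obtain ⟨j, hj⟩ := Finset.dvd_prod_of_mem k (hF.mem_toFinset.2 hw)
    rw [hj, pow_mul, hpow]
  have h2 : (⟨g, hg⟩ : G) ^ (∏ w ∈ hF.toFinset, k w) = 1 := Subtype.ext h1
  exact congrArg Subtype.val ((pow_eq_one_iff_left
    (Finset.prod_pos fun w _ => hk w).ne').1 h2)

theorem isMulTorsionFree_of_isFreeGroup (G : Type*) [Group G] [IsFreeGroup G] :
    IsMulTorsionFree G :=
  Function.Injective.isMulTorsionFree (IsFreeGroup.toFreeGroup G).toMonoidHom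
    (IsFreeGroup.toFreeGroup G).injective

end Discrete

/-! ### Tours of a subtree -/

section Tour

variable {V : Type*} {T : SimpleGraph V} {v₀ : V} {nbrs : V → List V} {L : List (T ≃g T)}

/-- The vertices on a path. -/
def visited (v₀ : V) (nbrs : V → List V) (L : List (T ≃g T)) (a : List ℕ) : Set V :=
  Set.range fun j => evalVertex v₀ nbrs L (pathName a j)

theorem visited_nil : visited v₀ nbrs L [] = {v₀} := by
  ext v
  simp [visited, pathName, evalVertex, eq_comm]

theorem visited_cons (k : ℕ) (a : List ℕ) : visited v₀ nbrs L (k :: a) =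
    insert (evalVertex v₀ nbrs L (pathName (k :: a) 0)) (visited v₀ nbrs L a) := by
  ext v
  constructor
  · rintro ⟨_ | j, rfl⟩
    · exact Or.inl rfl
    · exact Or.inr ⟨j, rfl⟩
  · rintro (rfl | ⟨j, rfl⟩)
    · exact ⟨0, rfl⟩
    · exact ⟨j + 1, rfl⟩

theorem base_mem_visited (a : List ℕ) : v₀ ∈ visited v₀ nbrs L a :=
  ⟨a.length, by simp [pathName, evalVertex]⟩

/-- An index out of range means standing still. Arbitrary numbers in a certificate thus still trace
a connected path, and no ranges have to be tested. -/
theorem getD_eq_or_adj (hn : ∀ v w, w ∈ nbrs v ↔ T.Adj v w) (k : ℕ) (v : V) :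
    (nbrs v).getD k v = v ∨ T.Adj v ((nbrs v).getD k v) := by
  by_cases hk : k < (nbrs v).length
  · right
    rw [← hn, List.getD_eq_getElem _ _ hk]
    exact List.getElem_mem hk
  · left
    exact List.getD_eq_default _ _ (not_lt.1 hk)

theorem exists_getD_eq_of_adj (hn : ∀ v w, w ∈ nbrs v ↔ T.Adj v w) {v w : V} (h : T.Adj v w) :
    ∃ k, (nbrs v).getD k v = w := by
  obtain ⟨k, hk, rfl⟩ := List.getElem_of_mem ((hn v w).2 h)
  exact ⟨k, List.getD_eq_getElem _ _ hk⟩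

theorem connectedFrom_visited (hn : ∀ v w, w ∈ nbrs v ↔ T.Adj v w) (a : List ℕ) :
    ConnectedFrom T v₀ (visited v₀ nbrs L a) := by
  induction a with
  | nil =>
    intro v hv
    rw [visited_nil] at hv
    rw [Set.mem_singleton_iff.1 hv]
  | cons k a ih =>
    have hsub : visited v₀ nbrs L a ⊆ visited v₀ nbrs L (k :: a) := by
      rw [visited_cons]
      exact Set.subset_insert _ _
    have hold : ∀ v ∈ visited v₀ nbrs L a,
        ReflTransGen (fun b c => T.Adj b c ∧ c ∈ visited v₀ nbrs L (k :: a)) v₀ v := fun v hv =>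
      ReflTransGen.mono (fun b c h => ⟨h.1, hsub h.2⟩) _ _ (ih v hv)
    intro v hv
    have hv' := hv
    rw [visited_cons] at hv
    rcases hv with rfl | hv
    · rcases getD_eq_or_adj hn k (evalVertex v₀ nbrs L (pathName a 0)) with h | h
      · have : evalVertex v₀ nbrs L (pathName (k :: a) 0) =
          evalVertex v₀ nbrs L (pathName a 0) := h
        rw [this]
        exact hold _ ⟨0, rfl⟩
      · exact ReflTransGen.tail (hold _ ⟨0, rfl⟩) ⟨h, hv'⟩
    · exact hold v hv

/-- A path may backtrack and revisit vertices, so it can be prolonged step by step along any walk in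
`D`. -/
theorem exists_extension (hn : ∀ v w, w ∈ nbrs v ↔ T.Adj v w) {D : Set V} {x y : V}
    (h : ReflTransGen (fun b c => T.Adj b c ∧ c ∈ D) x y) {a : List ℕ}
    (hx : evalVertex v₀ nbrs L (pathName a 0) = x) (ha : visited v₀ nbrs L a ⊆ D) :
    ∃ a', evalVertex v₀ nbrs L (pathName a' 0) = y ∧ visited v₀ nbrs L a' ⊆ D ∧
      visited v₀ nbrs L a ⊆ visited v₀ nbrs L a' := by
  induction h with
  | refl => exact ⟨a, hx, ha, subset_rfl⟩
  | @tail y z _ hyz ih =>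
    obtain ⟨a', hy, ha', hs⟩ := ih
    obtain ⟨k, hk⟩ := exists_getD_eq_of_adj hn hyz.1
    have hz : evalVertex v₀ nbrs L (pathName (k :: a') 0) = z := by
      rw [← hk, ← hy]
      rfl
    refine ⟨k :: a', hz, ?_, ?_⟩
    · rw [visited_cons, hz]
      exact Set.insert_subset hyz.2 ha'
    · rw [visited_cons]
      exact hs.trans (Set.subset_insert _ _)

/-- Every vertex has a name. -/
theorem exists_evalVertex_eq (hc : T.Connected) (hn : ∀ v w, w ∈ nbrs v ↔ T.Adj v w) (v : V) :
    ∃ p, evalVertex v₀ nbrs L p = v := by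
  have h := (SimpleGraph.reachable_iff_reflTransGen _ _).1 (hc.preconnected v₀ v)
  obtain ⟨a, ha, -⟩ := exists_extension (L := L) hn (D := Set.univ)
    (ReflTransGen.mono (fun b c h => ⟨h, trivial⟩) _ _ h) (a := []) rfl (Set.subset_univ _)
  exact ⟨_, ha⟩

theorem ConnectedFrom.reflTransGen {D : Set V} (hD : ConnectedFrom T v₀ D) (hv₀ : v₀ ∈ D) {x y : V}
    (hx : x ∈ D) (hy : y ∈ D) : ReflTransGen (fun b c => T.Adj b c ∧ c ∈ D) x y := by
  have key : ∀ x, ReflTransGen (fun b c => T.Adj b c ∧ c ∈ D) v₀ x →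
      x ∈ D ∧ ReflTransGen (fun b c => T.Adj b c ∧ c ∈ D) x v₀ := by
    intro x hx
    induction hx with
    | refl => exact ⟨hv₀, ReflTransGen.refl⟩
    | tail _ hbc ih => exact ⟨hbc.2, ReflTransGen.head ⟨hbc.1.symm, ih.1⟩ ih.2⟩
  exact (key x (hD x hx)).2.trans (hD y hy)

/-- A subtree contains a path that visits finitely many given vertices. -/
theorem exists_tour (hn : ∀ v w, w ∈ nbrs v ↔ T.Adj v w) {D : Set V} (hD : ConnectedFrom T v₀ D)
    (hv₀ : v₀ ∈ D) {S : Set V} (hS : S.Finite) (hSD : S ⊆ D) :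
    ∃ a, visited v₀ nbrs L a ⊆ D ∧ S ⊆ visited v₀ nbrs L a := by
  induction S, hS using Set.Finite.induction_on with
  | empty => exact ⟨[], by rw [visited_nil]; simpa using hv₀, Set.empty_subset _⟩
  | @insert s S _ _ ih =>
    obtain ⟨a, ha, hSa⟩ := ih ((Set.subset_insert _ _).trans hSD)
    obtain ⟨a', hs, ha', haa'⟩ := exists_extension hn
      (hD.reflTransGen hv₀ (ha ⟨0, rfl⟩) (hSD (Set.mem_insert _ _))) rfl ha
    exact ⟨a', ha', Set.insert_subset ⟨0, hs⟩ (hSa.trans haa')⟩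

end Tour

/-! ### Fundamental domains of free actions -/

section FundamentalDomain

variable {V : Type*} {T : SimpleGraph V}

/-- A group of automorphisms of a connected graph has a connected set of orbit representatives. -/
theorem exists_connected_transversal (hc : T.Connected) (G : Subgroup (T ≃g T)) (v₀ : V) :
    ∃ D : Set V, v₀ ∈ D ∧ ConnectedFrom T v₀ D ∧
      (∀ d ∈ D, ∀ d' ∈ D, ∀ g ∈ G, g d = d' → d = d') ∧ ∀ v, ∃ d ∈ D, ∃ g ∈ G, g d = v := by
  obtain ⟨D, hsub, hmax⟩ := zorn_subset_nonempty
    {D : Set V | v₀ ∈ D ∧ ConnectedFrom T v₀ D ∧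
      ∀ d ∈ D, ∀ d' ∈ D, ∀ g ∈ G, g d = d' → d = d'} (by
      intro c hcS hchain hne
      refine ⟨⋃₀ c, ⟨?_, ?_, ?_⟩, fun s hs => Set.subset_sUnion_of_mem hs⟩
      · obtain ⟨s, hs⟩ := hne
        exact ⟨s, hs, (hcS hs).1⟩
      · rintro v ⟨s, hs, hv⟩
        exact ReflTransGen.mono (fun a b h => ⟨h.1, s, hs, h.2⟩) _ _ ((hcS hs).2.1 v hv)
      · rintro d ⟨s, hs, hd⟩ d' ⟨s', hs', hd'⟩
        rcases hchain.total hs hs' with h | h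
        · exact (hcS hs').2.2 d (h hd) d' hd'
        · exact (hcS hs).2.2 d hd d' (h hd')) {v₀} (by
      refine ⟨rfl, ?_, ?_⟩
      · rintro v rfl
        exact ReflTransGen.refl
      · rintro d rfl d' rfl g _ _
        rfl)
  obtain ⟨h₀, hconn, hinj⟩ := hmax.prop
  refine ⟨D, h₀, hconn, hinj, fun v => ?_⟩
  refine mem_of_closed_of_connected hc (S := {v | ∃ d ∈ D, ∃ g ∈ G, g d = v})
    ⟨v₀, h₀, 1, G.one_mem, rfl⟩ ?_ v
  rintro _ b hab ⟨d, hd, g, hg, rfl⟩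
  by_contra hb
  -- The vertex `g.symm b` is a neighbour of `d ∈ D` in an orbit that `D` misses, so adding it to
  -- `D` contradicts maximality.
  have hb' : ∀ d' ∈ D, ∀ k ∈ G, k d' ≠ g.symm b := by
    intro d' hd' k hk he
    refine hb ⟨d', hd', g * k, G.mul_mem hg hk, ?_⟩
    rw [RelIso.mul_apply, he, g.apply_symm_apply]
  have hadj : T.Adj d (g.symm b) := by
    rw [← g.map_rel_iff, g.apply_symm_apply]
    exact hab
  refine hb' (g.symm b) (hmax.le_of_ge (y := insert (g.symm b) D) ⟨Or.inr h₀, ?_, ?_⟩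
    (Set.subset_insert _ _) (Set.mem_insert _ _)) 1 G.one_mem rfl
  · have hold : ∀ v ∈ D,
        ReflTransGen (fun a c => T.Adj a c ∧ c ∈ insert (g.symm b) D) v₀ v := fun v hv =>
      ReflTransGen.mono (fun _ _ h => ⟨h.1, Or.inr h.2⟩) _ _ (hconn v hv)
    rintro v (rfl | hv)
    · exact (hold d hd).tail ⟨hadj, Or.inl rfl⟩
    · exact hold v hv
  · rintro x (rfl | hx) y (rfl | hy) k hk he
    · rfl
    · exact absurd (by rw [← he, ← RelIso.mul_apply, inv_mul_cancel]; rfl)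
        (hb' y hy k⁻¹ (G.inv_mem hk))
    · exact absurd he (hb' x hx k hk)
    · exact hinj x hx y hy k hk he

/-- The elements that move a set of vertices to a neighbouring one. -/
def neighbourElements (T : SimpleGraph V) (G : Subgroup (T ≃g T)) (D : Set V) : Set (T ≃g T) :=
  {g | g ∈ G ∧ g ≠ 1 ∧ ∃ d ∈ D, ∃ d' ∈ D, T.Adj d (g d')}

/-- Along a path from `v₀`, a step from `g d` to `g' d'` makes `g⁻¹ * g'` trivial or a neighbour
element. At the start, `g d = v₀` forces `d = v₀` and, by freeness, `g = 1`. -/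
theorem le_closure_neighbourElements (hc : T.Connected) {G : Subgroup (T ≃g T)} {v₀ : V}
    {D : Set V} (hfree : ∀ g ∈ G, ∀ v, g v = v → g = 1) (h₀ : v₀ ∈ D)
    (hinj : ∀ d ∈ D, ∀ d' ∈ D, ∀ g ∈ G, g d = d' → d = d')
    (hsurj : ∀ v, ∃ d ∈ D, ∃ g ∈ G, g d = v) :
    G ≤ Subgroup.closure (neighbourElements T G D) := by
  have key : ∀ v, v ∈ {v | ∀ d ∈ D, ∀ g ∈ G, g d = v →
      g ∈ Subgroup.closure (neighbourElements T G D)} := by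
    refine mem_of_closed_of_connected hc (s := v₀) ?_ ?_
    · intro d hd g hg h
      obtain rfl := hinj d hd v₀ h₀ g hg h
      rw [hfree g hg d h]
      exact Subgroup.one_mem _
    · rintro a b hab ha d' hd' g' hg' rfl
      obtain ⟨d, hd, g, hg, rfl⟩ := hsurj a
      have hgm := ha d hd g hg rfl
      have hadj : T.Adj d ((g⁻¹ * g') d') := by
        have h : T.Adj (g d) (g ((g⁻¹ * g') d')) := by
          rwa [← RelIso.mul_apply g, mul_inv_cancel_left]
        exact g.map_rel_iff.1 h
      have hm : g⁻¹ * g' ∈ Subgroup.closure (neighbourElements T G D) := by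
        by_cases h1 : g⁻¹ * g' = 1
        · rw [h1]
          exact Subgroup.one_mem _
        · exact Subgroup.subset_closure
            ⟨G.mul_mem (G.inv_mem hg) hg', h1, d, hd, d', hd', hadj⟩
      simpa using Subgroup.mul_mem _ hgm hm
  exact fun g hg => key (g v₀) v₀ h₀ g hg rfl

end FundamentalDomain

/-! ### Finite generating sets -/

section Generators

variable {G : Type*} [Group G]

theorem exists_finset_closure_of_finite {X E : Set G} (hX : X.Finite)
    (hXE : X ⊆ Subgroup.closure E) :
    ∃ F : Finset G, (F : Set G) ⊆ E ∧ X ⊆ Subgroup.closure (F : Set G) := by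
  classical
  have mono : ∀ F F' : Finset G, F ⊆ F' →
      Subgroup.closure (F : Set G) ≤ Subgroup.closure (F' : Set G) := fun F F' h =>
    Subgroup.closure_mono (Finset.coe_subset.2 h)
  have one : ∀ g ∈ Subgroup.closure E,
      ∃ F : Finset G, (F : Set G) ⊆ E ∧ g ∈ Subgroup.closure (F : Set G) := by
    intro g hg
    induction hg using Subgroup.closure_induction with
    | mem x hx => exact ⟨{x}, by simpa using hx, Subgroup.subset_closure (by simp)⟩
    | one => exact ⟨∅, by simp, Subgroup.one_mem _⟩
    | mul x y _ _ hx hy =>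
      obtain ⟨F, hF, hx⟩ := hx
      obtain ⟨F', hF', hy⟩ := hy
      exact ⟨F ∪ F', by simpa using ⟨hF, hF'⟩, Subgroup.mul_mem _
        (mono _ _ Finset.subset_union_left hx) (mono _ _ Finset.subset_union_right hy)⟩
    | inv x _ hx =>
      obtain ⟨F, hF, hx⟩ := hx
      exact ⟨F, hF, Subgroup.inv_mem _ hx⟩
  induction X, hX using Set.Finite.induction_on with
  | empty => exact ⟨∅, by simp, by simp⟩
  | @insert x X _ _ ih =>
    obtain ⟨F, hF, hX⟩ := ih ((Set.subset_insert _ _).trans hXE)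
    obtain ⟨F', hF', hx⟩ := one x (hXE (Set.mem_insert _ _))
    exact ⟨F ∪ F', by simpa using ⟨hF, hF'⟩, Set.insert_subset
      (mono _ _ Finset.subset_union_right hx)
      (hX.trans (mono _ _ Finset.subset_union_left))⟩

/-- A finite generating set can be thinned out so that it contains no two mutually inverse
elements. -/
theorem exists_finset_closure_mul_ne_one {X E : Set G} (hX : X.Finite)
    (hXE : X ⊆ Subgroup.closure E) (hE : ∀ g ∈ E, g * g ≠ 1) :
    ∃ F : Finset G, (F : Set G) ⊆ E ∧ X ⊆ Subgroup.closure (F : Set G) ∧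
      ∀ g ∈ F, ∀ h ∈ F, g * h ≠ 1 := by
  classical
  have hex : ∃ n, ∃ F : Finset G, F.card = n ∧ (F : Set G) ⊆ E ∧
      X ⊆ Subgroup.closure (F : Set G) := by
    obtain ⟨F, hF⟩ := exists_finset_closure_of_finite hX hXE
    exact ⟨_, F, rfl, hF⟩
  obtain ⟨F, hcard, hF, hXF⟩ := Nat.find_spec hex
  refine ⟨F, hF, hXF, fun g hg h hh hgh => ?_⟩
  have hne : g ≠ h := by
    rintro rfl
    exact hE g (hF hg) hgh
  -- `F` has least cardinality, yet `g` could be erased, being the inverse of the remaining `h`.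
  refine Nat.find_min hex (m := (F.erase g).card)
    (hcard ▸ Finset.card_erase_lt_of_mem hg) ⟨F.erase g, rfl, ?_, ?_⟩
  · exact (Finset.coe_subset.2 (Finset.erase_subset _ _)).trans hF
  · refine hXF.trans ((Subgroup.closure_le _).2 fun x hx => ?_)
    by_cases hxg : x = g
    · rw [show x = h⁻¹ from hxg.trans (eq_inv_of_mul_eq_one_left hgh)]
      exact Subgroup.inv_mem _ (Subgroup.subset_closure
        (Finset.mem_coe.2 (Finset.mem_erase.2 ⟨hne.symm, hh⟩)))
    · exact Subgroup.subset_closure (Finset.mem_coe.2 (Finset.mem_erase.2 ⟨hxg, hx⟩))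

end Generators

/-! ### Words -/

section Words

variable {V : Type*} {T : SimpleGraph V} {L : List (T ≃g T)}

theorem evalLetter_mem_closure {X : Set (T ≃g T)} (hX : ∀ g ∈ L, g ∈ X) (a : Letter) :
    evalLetter L a ∈ Subgroup.closure X := by
  have h : L.getD a.1 1 ∈ Subgroup.closure X := by
    by_cases ha : a.1 < L.length
    · rw [List.getD_eq_getElem _ _ ha]
      exact Subgroup.subset_closure (hX _ (List.getElem_mem ha))
    · rw [List.getD_eq_default _ _ (not_lt.1 ha)]
      exact Subgroup.one_mem _
  rw [evalLetter]
  split_ifs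
  · exact h
  · exact Subgroup.inv_mem _ h

theorem evalWord_mem_closure {X : Set (T ≃g T)} (hX : ∀ g ∈ L, g ∈ X) (w : Word) :
    evalWord L w ∈ Subgroup.closure X := by
  refine Subgroup.list_prod_mem _ fun g hg => ?_
  obtain ⟨a, -, rfl⟩ := List.mem_map.1 hg
  exact evalLetter_mem_closure hX a

theorem evalWord_map_invLetter_reverse (w : Word) :
    evalWord L (w.reverse.map invLetter) = (evalWord L w)⁻¹ := by
  induction w with
  | nil => simp [evalWord]
  | cons a w ih =>
    rw [List.reverse_cons, List.map_append, evalWord_append, ih, evalWord_cons, mul_inv_rev,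
      ← evalLetter_invLetter]
    simp [evalWord]

theorem exists_evalWord_eq {X : Set (T ≃g T)} (hX : ∀ g ∈ X, g ∈ L) {g : T ≃g T}
    (hg : g ∈ Subgroup.closure X) : ∃ w, evalWord L w = g := by
  induction hg using Subgroup.closure_induction with
  | mem x hx =>
    obtain ⟨i, hi, rfl⟩ := List.getElem_of_mem (hX x hx)
    exact ⟨[(i, true)], by simp [evalWord, evalLetter, hi]⟩
  | one => exact ⟨[], rfl⟩
  | mul x y _ _ hx hy =>
    obtain ⟨w, rfl⟩ := hx
    obtain ⟨w', rfl⟩ := hy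
    exact ⟨w ++ w', evalWord_append w w'⟩
  | inv x _ hx =>
    obtain ⟨w, rfl⟩ := hx
    exact ⟨_, evalWord_map_invLetter_reverse w⟩

theorem evalWord_substWord (E : List (Half × Half)) (z : Word) :
    evalWord L (substWord E z) = (z.map fun l => evalWord L (half E l).1).prod := by
  induction z with
  | nil => rfl
  | cons l z ih =>
    rw [substWord, List.flatMap_cons, evalWord_append, List.map_cons, List.prod_cons, ← ih]
    rfl

end Words

/-! ### Soundness and completeness of the certificates -/

section Certificates

variable {V : Type*} {T : SimpleGraph V} {v₀ : V} {nbrs : V → List V} {L : List (T ≃g T)}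

/-- The default half carries the empty word, so a letter out of range denotes the identity and is
harmless. -/
theorem half_of_length_le {E : List (Half × Half)} {l : Letter} (hl : E.length ≤ l.1) :
    half E l = default := by
  rcases l with ⟨i, _ | _⟩ <;> simp only [half] <;> rw [List.getD_eq_default _ _ hl] <;> rfl

/-- A confirmed ping-pong certificate shows that the group is discrete and free. -/
theorem isDiscreteSubgroup_and_isFreeGroup_of_tests (hT : T.IsTree)
    (hn : ∀ v w, w ∈ nbrs v ↔ T.Adj v w) {X : Set (T ≃g T)} (hX : ∀ g, g ∈ L ↔ g ∈ X)
    {c : PingPongCertificate}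
    (h : ∀ t ∈ pingPongTests L.length c, answer v₀ nbrs L t.1 = t.2) :
    IsDiscreteSubgroup T (Subgroup.closure X) ∧ IsFreeGroup (Subgroup.closure X) := by
  obtain ⟨a, E, Z⟩ := c
  obtain ⟨hinv, hmove, hoff, hdist, hgen⟩ := (pingPongTests_iff _ a E Z).1 h
  let o : Letter → V := fun l => evalVertex v₀ nbrs L (originName a E l)
  let u : Letter → V := fun l => evalVertex v₀ nbrs L (targetName a E l)
  let y : Letter → (T ≃g T) := fun l => evalWord L (half E l).1
  have ho : ∀ l, o l ∈ visited v₀ nbrs L a := fun l => ⟨_, rfl⟩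
  have hu : ∀ l : Letter, l.1 < E.length → u l ∉ visited v₀ nbrs L a := by
    rintro l hl ⟨j, hj⟩
    -- Positions beyond the path denote the base vertex, as position `a.length` already does.
    rcases le_total j a.length with hja | hja
    · exact hoff l hl j hja hj.symm
    · refine hoff l hl a.length le_rfl (hj.symm.trans ?_)
      simp [pathName, List.drop_eq_nil_of_le hja]
  have hadj : ∀ l : Letter, l.1 < E.length → T.Adj (o l) (u l) := by
    intro l hl
    refine (getD_eq_or_adj hn (half E l).2.2 (o l)).resolve_left fun he => hu l hl ?_
    have : u l = o l := he
    rw [this]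
    exact ho l
  have hconn := connectedFrom_visited (v₀ := v₀) (L := L) hn a
  have hbase := base_mem_visited (v₀ := v₀) (nbrs := nbrs) (L := L) a
  have hback : ∀ l : Letter, l.1 < E.length → y l (u (invLetter l)) = o l := by
    intro l hl
    have h1 : y (invLetter l) (o (invLetter (invLetter l))) = u (invLetter l) :=
      hmove (invLetter l) hl
    have h2 : invLetter (invLetter l) = l := by simp [invLetter]
    rw [h2] at h1
    rw [← h1, ← RelIso.mul_apply]
    show (evalWord L (half E l).1 * evalWord L (half E (invLetter l)).1) (o l) = o l
    rw [hinv l hl]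
    rfl
  have hping : ∀ l : Letter, l.1 < E.length →
      ∀ v ∉ halfTree T (o (invLetter l)) (u (invLetter l)), y l v ∈ halfTree T (o l) (u l) :=
    fun l hl v hv => map_mem_halfTree_of_notMem hT.connected (y l) (hmove l hl) (hback l hl) hv
  let f : Fin E.length → (T ≃g T) := fun i => y (i, true)
  have hf : ∀ i : Fin E.length, (f i)⁻¹ = y (i, false) := fun i =>
    inv_eq_of_mul_eq_one_right (hinv (i, true) i.2)
  let U : Fin E.length × Bool → Set V := fun l => halfTree T (o (l.1, l.2)) (u (l.1, l.2))
  -- This one statement yields both conclusions: the lift is injective, and the stabiliser of `v₀`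
  -- in its range is trivial.
  have hstab : ∀ x : FreeGroup (Fin E.length), FreeGroup.lift f x v₀ = v₀ → x = 1 := by
    intro x hx
    refine eq_one_of_lift_smul_eq f U v₀ (fun l => ?_) (fun l l' hll => ?_) (fun i v hv => ?_)
      (fun i v hv => ?_) hx
    · exact notMem_halfTree_of_connectedFrom hT.isAcyclic hconn hbase (hadj _ l.1.2) (ho _)
        (hu _ l.1.2) _ hbase
    · refine disjoint_halfTree_of_connectedFrom hT hconn hbase (hadj _ l.1.2) (ho _) (hu _ l.1.2)
        (hadj _ l'.1.2) (ho _) (hu _ l'.1.2) fun he => hll ?_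
      have := hdist (l.1, l.2) (l'.1, l'.2) l.1.2 l'.1.2 he
      simp only [Prod.mk.injEq] at this
      exact Prod.ext (Fin.ext this.1) this.2
    · exact hping (i, true) i.2 v hv
    · rw [hf]
      exact hping (i, false) i.2 v hv
  have hmem : ∀ l, y l ∈ (FreeGroup.lift f).range := by
    rintro ⟨i, b⟩
    by_cases hi : i < E.length
    · have hfi : f ⟨i, hi⟩ ∈ (FreeGroup.lift f).range :=
        ⟨FreeGroup.of ⟨i, hi⟩, FreeGroup.lift_apply_of⟩
      cases b
      · exact hf ⟨i, hi⟩ ▸ Subgroup.inv_mem _ hfi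
      · exact hfi
    · have : y (i, b) = 1 := by
        show evalWord L (half E (i, b)).1 = 1
        rw [half_of_length_le (not_lt.1 hi)]
        rfl
      rw [this]
      exact Subgroup.one_mem _
  have hrange : Subgroup.closure X = (FreeGroup.lift f).range := by
    refine le_antisymm ((Subgroup.closure_le _).2 fun g hg => ?_) ?_
    · obtain ⟨i, hi, rfl⟩ := List.getElem_of_mem ((hX g).2 hg)
      have := hgen i hi
      rw [List.getD_eq_getElem _ _ hi, evalWord_substWord] at this
      rw [← this]
      refine Subgroup.list_prod_mem _ fun k hk => ?_
      obtain ⟨l, -, rfl⟩ := List.mem_map.1 hk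
      exact hmem l
    · rw [FreeGroup.range_lift_eq_closure, Subgroup.closure_le]
      rintro _ ⟨i, rfl⟩
      exact evalWord_mem_closure (fun g => (hX g).1) _
  rw [hrange]
  refine ⟨isDiscreteSubgroup_of_stabilizer v₀ ?_, ?_⟩
  · rintro _ ⟨x, rfl⟩ hx
    rw [hstab x hx, map_one]
  · have hinj : Function.Injective (FreeGroup.lift f) := by
      refine (injective_iff_map_eq_one _).2 fun x hx => hstab x ?_
      rw [hx]
      rfl
    exact IsFreeGroup.ofMulEquiv (MonoidHom.ofInjective hinj)

/-- If no nontrivial element fixes a vertex or is an involution, then there is a ping-pong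
certificate. -/
theorem exists_pingPongTests (hc : T.Connected) (hn : ∀ v w, w ∈ nbrs v ↔ T.Adj v w)
    {X : Set (T ≃g T)} (hX : ∀ g, g ∈ L ↔ g ∈ X)
    (hfree : ∀ g ∈ Subgroup.closure X, ∀ v, g v = v → g = 1)
    (hinvol : ∀ g ∈ Subgroup.closure X, g * g = 1 → g = 1) :
    ∃ c, ∀ t ∈ pingPongTests L.length c, answer v₀ nbrs L t.1 = t.2 := by
  obtain ⟨D, h₀, hconn, hinj, hsurj⟩ := exists_connected_transversal hc (Subgroup.closure X) v₀
  have hXfin : X.Finite := (List.finite_toSet L).subset fun g hg => (hX g).2 hg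
  obtain ⟨F, hFE, hXF, hFF⟩ := exists_finset_closure_mul_ne_one hXfin
    (Subgroup.subset_closure.trans (le_closure_neighbourElements hc hfree h₀ hinj hsurj))
    fun g hg h => hg.2.1 (hinvol g hg.1 h)
  have hFX : ∀ g ∈ F, g ∈ Subgroup.closure X := fun g hg => (hFE hg).1
  have : Nonempty V := ⟨v₀⟩
  choose! o ho o' ho' hadj using fun g (hg : g ∈ F) => (hFE hg).2.2
  have hadj' : ∀ g ∈ F, T.Adj (o' g) (g⁻¹ (o g)) := by
    intro g hg
    have h : T.Adj (g (o' g)) (g (g⁻¹ (o g))) := by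
      rw [← RelIso.mul_apply, mul_inv_cancel]
      exact (hadj g hg).symm
    exact g.map_rel_iff.1 h
  -- `D` may be infinite; only a finite part that connects the origins of the chosen edges is
  -- needed.
  obtain ⟨a, haD, hoa⟩ := exists_tour (L := L) hn hconn h₀
    (S := o '' F ∪ o' '' F) ((F.finite_toSet.image _).union (F.finite_toSet.image _)) (by
      rintro _ (⟨g, hg, rfl⟩ | ⟨g, hg, rfl⟩)
      · exact ho g hg
      · exact ho' g hg)
  have hhalf : ∀ g ∈ Subgroup.closure X, ∀ v ∈ visited v₀ nbrs L a, ∀ w, T.Adj v w →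
      ∃ e : Half, evalWord L e.1 = g ∧ evalVertex v₀ nbrs L (pathName a e.2.1) = v ∧
        evalVertex v₀ nbrs L (Sum.inl e.2.2 :: pathName a e.2.1) = w := by
    rintro g hg _ ⟨j, rfl⟩ w hw
    obtain ⟨y, hy⟩ := exists_evalWord_eq (fun g => (hX g).2) hg
    obtain ⟨k, hk⟩ := exists_getD_eq_of_adj hn hw
    exact ⟨(y, j, k), hy, rfl, hk⟩
  choose! e he₁ he₂ he₃ using fun g (hg : g ∈ F) =>
    hhalf g (hFX g hg) (o g) (hoa (Or.inl ⟨g, hg, rfl⟩)) _ (hadj g hg)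
  choose! e' he₁' he₂' he₃' using fun g (hg : g ∈ F) =>
    hhalf g⁻¹ (Subgroup.inv_mem _ (hFX g hg)) (o' g) (hoa (Or.inr ⟨g, hg, rfl⟩)) _ (hadj' g hg)
  let E : List (Half × Half) := F.toList.map fun g => (e g, e' g)
  let γ : Letter → (T ≃g T) := evalLetter F.toList
  -- The edge of a letter `l` runs from `p l` in `D` to `γ l (p (invLetter l))` in the translate of
  -- `D` by `γ l`.
  let p : Letter → V := fun l => bif l.2 then o (F.toList.getD l.1 1) else o' (F.toList.getD l.1 1)
  have hElen : E.length = F.toList.length := List.length_map _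
  have hspec : ∀ l : Letter, l.1 < E.length → evalWord L (half E l).1 = γ l ∧
      evalVertex v₀ nbrs L (originName a E l) = p l ∧ p l ∈ D ∧
      evalVertex v₀ nbrs L (targetName a E l) = γ l (p (invLetter l)) := by
    rintro ⟨i, b⟩ hi
    have hi' : i < F.toList.length := hElen ▸ hi
    have hmem : F.toList[i] ∈ F := Finset.mem_toList.1 (List.getElem_mem hi')
    have hE : E.getD i default = (e F.toList[i], e' F.toList[i]) := by
      rw [List.getD_eq_getElem _ _ hi]
      simp [E]
    have hd : F.toList.getD i 1 = F.toList[i] := List.getD_eq_getElem _ _ hi'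
    cases b
    · simp only [half, originName, targetName, γ, p, evalLetter, invLetter, hE, hd, cond_false,
        Bool.not_false, cond_true, Bool.false_eq_true, if_false]
      exact ⟨he₁' _ hmem, he₂' _ hmem, ho' _ hmem, he₃' _ hmem⟩
    · simp only [half, originName, targetName, γ, p, evalLetter, invLetter, hE, hd, cond_false,
        Bool.not_true, cond_true, if_true]
      exact ⟨he₁ _ hmem, he₂ _ hmem, ho _ hmem, he₃ _ hmem⟩
  have hget : ∀ i, i < E.length → F.toList.getD i 1 ∈ F := by
    intro i hi
    rw [List.getD_eq_getElem _ _ (hElen ▸ hi)]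
    exact Finset.mem_toList.1 (List.getElem_mem _)
  have hγ : ∀ l : Letter, l.1 < E.length → γ l ∈ Subgroup.closure X ∧ γ l ≠ 1 := by
    rintro ⟨i, b⟩ hi
    have hm := hget i hi
    cases b
    · exact ⟨Subgroup.inv_mem _ (hFX _ hm), inv_ne_one.2 (hFE hm).2.1⟩
    · exact ⟨hFX _ hm, (hFE hm).2.1⟩
  -- For letters of opposite sign, equality would give a mutually inverse pair in `F` (possibly one
  -- element twice), which the choice of `F` excludes.
  have hγinj : ∀ l l' : Letter, l.1 < E.length → l'.1 < E.length → γ l = γ l' → l = l' := by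
    have hidx : ∀ i j, i < E.length → j < E.length →
        F.toList.getD i 1 = F.toList.getD j 1 → i = j := by
      intro i j hi hj h
      rw [hElen] at hi hj
      rw [List.getD_eq_getElem _ _ hi, List.getD_eq_getElem _ _ hj] at h
      exact F.nodup_toList.getElem_inj_iff.1 h
    rintro ⟨i, b⟩ ⟨j, b'⟩ hi hj h
    cases b <;> cases b'
    · rw [hidx i j hi hj (inv_injective h)]
    · have h' : (F.toList.getD i 1)⁻¹ = F.toList.getD j 1 := h
      exact absurd (h' ▸ mul_inv_cancel _) (hFF _ (hget i hi) _ (hget j hj))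
    · have h' : F.toList.getD i 1 = (F.toList.getD j 1)⁻¹ := h
      exact absurd (mul_eq_one_iff_eq_inv.2 h') (hFF _ (hget i hi) _ (hget j hj))
    · rw [hidx i j hi hj h]
  have hword : ∀ z, evalWord L (substWord E z) = evalWord F.toList z := by
    intro z
    rw [evalWord_substWord]
    refine congrArg List.prod (List.map_congr_left fun l _ => ?_)
    by_cases hl : l.1 < E.length
    · exact (hspec l hl).1
    · rw [half_of_length_le (not_lt.1 hl), evalLetter,
        List.getD_eq_default _ _ (hElen ▸ not_lt.1 hl)]
      simp only [inv_one, ite_self]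
      rfl
  have hz : ∀ g ∈ L, ∃ z, evalWord L (substWord E z) = g := by
    intro g hg
    obtain ⟨z, hz⟩ := exists_evalWord_eq (L := F.toList) (X := (F : Set (T ≃g T)))
      (fun k hk => Finset.mem_toList.2 hk) (hXF ((hX g).1 hg))
    exact ⟨z, (hword z).trans hz⟩
  choose! z hz using hz
  refine ⟨(a, E, L.map z), (pingPongTests_iff _ _ _ _).2 ⟨fun l hl => ?_, fun l hl => ?_,
    fun l hl j _ => ?_, fun l l' hl hl' h => ?_, fun i hi => ?_⟩⟩
  · rw [(hspec l hl).1, (hspec (invLetter l) hl).1]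
    show evalLetter F.toList l * evalLetter F.toList (invLetter l) = 1
    rw [evalLetter_invLetter, mul_inv_cancel]
  · rw [(hspec l hl).1, (hspec (invLetter l) hl).2.1, (hspec l hl).2.2.2]
  · rw [(hspec l hl).2.2.2]
    -- A far end in `D` would be equal to the point of `D` from which `γ l` moves it, giving `γ l` a
    -- fixed vertex.
    intro h
    have hm : γ l (p (invLetter l)) ∈ D := h ▸ haD ⟨j, rfl⟩
    have hp := hinj _ (hspec (invLetter l) hl).2.2.1 _ hm _ (hγ l hl).1 rfl
    exact (hγ l hl).2 (hfree _ (hγ l hl).1 _ hp.symm)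
  · rw [(hspec l hl).2.2.2, (hspec l' hl').2.2.2] at h
    -- The two points of `D` lie in one orbit, so they coincide, and freeness gives `γ l = γ l'`.
    have h1 : ((γ l')⁻¹ * γ l) (p (invLetter l)) = p (invLetter l') := by
      rw [RelIso.mul_apply, h, ← RelIso.mul_apply, inv_mul_cancel, RelIso.one_apply]
    have hm := Subgroup.mul_mem _ (Subgroup.inv_mem _ (hγ l' hl').1) (hγ l hl).1
    have h2 := hinj _ (hspec (invLetter l) hl).2.2.1 _ (hspec (invLetter l') hl').2.2.1 _ hm h1
    exact hγinj l l' hl hl' (inv_mul_eq_one.1 (hfree _ hm _ (h1.trans h2.symm))).symm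
  · rw [List.getD_eq_getElem _ _ hi, List.getD_eq_getElem _ _ (by simpa using hi), List.getElem_map]
    exact hz _ (List.getElem_mem hi)

end Certificates

end TreeAut

theorem theoremB :
    ∃ A : TreeAut.Algorithm,
      ∀ (V : Type*) (T : SimpleGraph V), T.IsTree → (∀ v, (T.neighborSet v).Finite) →
      ∀ (v₀ : V) (nbrs : V → List V), (∀ v w, w ∈ nbrs v ↔ T.Adj v w) →
      ∀ (X : Finset (T ≃g T)) (L : List (T ≃g T)), (∀ g, g ∈ L ↔ g ∈ X) →
      ∀ G : Subgroup (T ≃g T), G = Subgroup.closure (X : Set (T ≃g T)) →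
      ∃ b : Bool, A.Outputs L.length (TreeAut.answer v₀ nbrs L) b ∧
        (b = true ↔ TreeAut.IsDiscreteSubgroup T G ∧ IsFreeGroup G) := by
  refine ⟨TreeAut.searchAlgorithm TreeAut.tests TreeAut.verdict TreeAut.primrec_tests
    TreeAut.primrec_verdict, fun V T hT hfin v₀ nbrs hn X L hX G hG => ?_⟩
  subst hG
  have hX' : ∀ g, g ∈ L ↔ g ∈ (X : Set (T ≃g T)) := hX
  have hex : ∃ c, ∀ t ∈ TreeAut.tests L.length c, TreeAut.answer v₀ nbrs L t.1 = t.2 := by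
    by_cases h : ∃ g ∈ Subgroup.closure (X : Set (T ≃g T)), g ≠ 1 ∧ ∃ v, g (g v) = v
    · obtain ⟨g, hg, hg1, v, hv⟩ := h
      obtain ⟨w, rfl⟩ := TreeAut.exists_evalWord_eq (fun g => (hX' g).2) hg
      obtain ⟨p, rfl⟩ :=
        TreeAut.exists_evalVertex_eq (v₀ := v₀) (L := L) hT.connected hn v
      exact ⟨Sum.inl (w, p), (TreeAut.ellipticTests_iff w p).2 ⟨hg1, hv⟩⟩
    · push Not at h
      -- A vertex fixed by `g` is fixed by its square, and the square of an involution fixes `v₀`;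
      -- both are excluded.
      obtain ⟨c, hc⟩ := TreeAut.exists_pingPongTests (v₀ := v₀) hT.connected hn hX'
        (fun g hg v hv => by
          by_contra h1
          exact h g hg h1 v (by rw [hv, hv]))
        (fun g hg hgg => by
          by_contra h1
          exact h g hg h1 v₀ (by rw [← RelIso.mul_apply, hgg, RelIso.one_apply]))
      exact ⟨Sum.inr c, hc⟩
  obtain ⟨c, hc, hout⟩ := TreeAut.searchAlgorithm_outputs TreeAut.primrec_tests
    TreeAut.primrec_verdict L.length (TreeAut.answer v₀ nbrs L) hex
  refine ⟨TreeAut.verdict c, hout, ?_⟩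
  rcases c with ⟨w, p⟩ | c
  · refine ⟨fun h => absurd h (by simp [TreeAut.verdict]), fun ⟨hd, hf⟩ => ?_⟩
    obtain ⟨hw, hwp⟩ := (TreeAut.ellipticTests_iff w p).1 hc
    have hmem := TreeAut.evalWord_mem_closure (fun g => (hX' g).1) w
    have := TreeAut.isMulTorsionFree_of_isFreeGroup (Subgroup.closure (X : Set (T ≃g T)))
    -- The square fixes a vertex, so it is trivial; torsion-freeness then contradicts the
    -- nontriviality of the word.
    have h1 := TreeAut.eq_one_of_apply_eq_of_isDiscreteSubgroup hT.connected hfin hd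
      (Subgroup.mul_mem _ hmem hmem) hwp
    have h2 : (⟨_, hmem⟩ : Subgroup.closure (X : Set (T ≃g T))) ^ 2 = 1 :=
      Subtype.ext ((pow_two _).trans h1)
    exact absurd (congrArg Subtype.val ((pow_eq_one_iff_left two_ne_zero).1 h2)) hw
  · exact ⟨fun _ => TreeAut.isDiscreteSubgroup_and_isFreeGroup_of_tests hT hn hX' hc,
      fun _ => rfl⟩
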